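/- Formulae of Propositional Contract Logic (PCL) over a set of atoms are generated by $p ::= a \mid \bot \mid \top \mid \neg p \mid p\land p \mid p\lor p \mid p\to p \mid p\twoheadrightarrow p$. Let $\Delta$ range over sets of formulae, and write $\Delta,p$ for $\Delta\cup\{p\}$. *Natural deduction* for PCL has the usual rules of intuitionistic propositional logic (identity, introduction of $\top$, ex falso, introduction and elimination for $\neg,\land,\lor,\to$) and the rules $$\frac{\Delta\vdash q}{\Delta\vdash p\twoheadrightarrow q}(\twoheadrightarrow I1)\qquad \frac{\Delta\vdash p'\twoheadrightarrow q'\quad \Delta,p\vdash p'\quad \Delta,q'\vdash p\twoheadrightarrow q}{\Delta\vdash p\twoheadrightarrow q}(\twoheadrightarrow I2)\qquad \frac{\Delta\vdash p\twoheadrightarrow q\quad \Delta,q\vdash p}{\Delta\vdash q}(\twoheadrightarrow E).$$ The *Gentzen sequent calculus* for PCL has the usual single-succedent rules of intuitionistic propositional logic (identity, Cut, $\top R$, $\bot L$, and left and right rules for $\neg,\land,\lor,\to$, the principal formula of a left rule being kept in the premises) and the rules $$\frac{\Gamma\vdash q}{\Gamma\vdash p\twoheadrightarrow q}(\mathrm{Zero})\qquad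 \frac{\Gamma,p\twoheadrightarrow q,r\vdash p\quad \Gamma,p\twoheadrightarrow q,q\vdash r}{\Gamma,p\twoheadrightarrow q\vdash r}(\mathrm{Fix})\qquad \frac{\Gamma,p\twoheadrightarrow q,a\vdash p\quad \Gamma,p\twoheadrightarrow q,q\vdash a\twoheadrightarrow b}{\Gamma,p\twoheadrightarrow q\vdash a\twoheadrightarrow b}(\mathrm{PrePost}),$$ where $a,b,p,q,r$ are arbitrary formulae. **Theorem.** For every set $\Delta$ of formulae and every formula $p$, there exists a natural deduction proof of $\Delta\vdash p$ if and only if there exists a proof of $\Delta\vdash p$ in the sequent calculus. The equivalence holds both for the sequent calculus with the rule Cut and for the sequent calculus without it. -/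

import Mathlib

namespace PCL

/-- Formulae of Propositional Contract Logic over a type of atoms: intuitionistic
propositional formulae extended with contractual implication. -/
inductive Formula (Atom : Type*) where
  | atom : Atom → Formula Atom
  | bot : Formula Atom
  | top : Formula Atom
  | neg : Formula Atom → Formula Atom
  | conj : Formula Atom → Formula Atom → Formula Atom
  | disj : Formula Atom → Formula Atom → Formula Atom
  | imp : Formula Atom → Formula Atom → Formula Atom
  /-- contractual implication -/
  | coimp : Formula Atom → Formula Atom → Formula Atom

open Formula

/-- Natural deduction for PCL: `ND Δ p` says that there is a natural deduction proof of
`Δ ⊢ p`. The context `Δ` is a set of formulae, and `Δ, p` is `insert p Δ`. -/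
inductive ND {Atom : Type*} : Set (Formula Atom) → Formula Atom → Prop
  | id {Δ p} : p ∈ Δ → ND Δ p
  | topI {Δ} : ND Δ top
  | botE {Δ p} : ND Δ bot → ND Δ p
  | negI {Δ p} : ND (insert p Δ) bot → ND Δ (neg p)
  | negE {Δ p} : ND Δ (neg p) → ND Δ p → ND Δ bot
  | andI {Δ p q} : ND Δ p → ND Δ q → ND Δ (conj p q)
  | andE1 {Δ p q} : ND Δ (conj p q) → ND Δ p
  | andE2 {Δ p q} : ND Δ (conj p q) → ND Δ q
  | orI1 {Δ p q} : ND Δ p → ND Δ (disj p q)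
  | orI2 {Δ p q} : ND Δ q → ND Δ (disj p q)
  | orE {Δ p q r} : ND Δ (disj p q) → ND (insert p Δ) r → ND (insert q Δ) r → ND Δ r
  | impI {Δ p q} : ND (insert p Δ) q → ND Δ (imp p q)
  | impE {Δ p q} : ND Δ (imp p q) → ND Δ p → ND Δ q
  | coimpI1 {Δ p q} : ND Δ q → ND Δ (coimp p q)
  | coimpI2 {Δ p q p' q'} : ND Δ (coimp p' q') → ND (insert p Δ) p' →
      ND (insert q' Δ) (coimp p q) → ND Δ (coimp p q)
  | coimpE {Δ p q} : ND Δ (coimp p q) → ND (insert q Δ) p → ND Δ q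

/-- Gentzen sequent calculus for PCL: `SC c Γ r` says that there is a sequent calculus proof of
`Γ ⊢ r`; the rule (Cut) may be used when `c = true`, and is absent when `c = false`.
Antecedents are sets of formulae, so a conclusion `Γ, p ⊢ r` is written as `Γ ⊢ r` with the
side condition that the principal formula `p` belongs to `Γ`; the principal formula of a left
rule remains available in the premises. -/
inductive SC {Atom : Type*} (c : Bool) : Set (Formula Atom) → Formula Atom → Prop
  | id {Γ p} : p ∈ Γ → SC c Γ p
  | cut {Γ p r} : c = true → SC c Γ p → SC c (insert p Γ) r → SC c Γ r
  | topR {Γ} : SC c Γ top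
  | botL {Γ r} : bot ∈ Γ → SC c Γ r
  | negR {Γ p} : SC c (insert p Γ) bot → SC c Γ (neg p)
  | negL {Γ p r} : neg p ∈ Γ → SC c Γ p → SC c Γ r
  | andR {Γ p q} : SC c Γ p → SC c Γ q → SC c Γ (conj p q)
  | andL1 {Γ p q r} : conj p q ∈ Γ → SC c (insert p Γ) r → SC c Γ r
  | andL2 {Γ p q r} : conj p q ∈ Γ → SC c (insert q Γ) r → SC c Γ r
  | orR1 {Γ p q} : SC c Γ p → SC c Γ (disj p q)
  | orR2 {Γ p q} : SC c Γ q → SC c Γ (disj p q)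
  | orL {Γ p q r} : disj p q ∈ Γ → SC c (insert p Γ) r → SC c (insert q Γ) r → SC c Γ r
  | impR {Γ p q} : SC c (insert p Γ) q → SC c Γ (imp p q)
  | impL {Γ p q r} : imp p q ∈ Γ → SC c Γ p → SC c (insert q Γ) r → SC c Γ r
  | zero {Γ p q} : SC c Γ q → SC c Γ (coimp p q)
  | fix {Γ p q r} : coimp p q ∈ Γ → SC c (insert r Γ) p → SC c (insert q Γ) r → SC c Γ r
  | prePost {Γ p q a b} : coimp p q ∈ Γ → SC c (insert a Γ) p →
      SC c (insert q Γ) (coimp a b) → SC c Γ (coimp a b)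

end PCL

namespace PCL

open Formula

variable {Atom : Type*}

/-! Elimination rules are left rules followed by a cut, and left rules are derivable in natural
deduction, so natural deduction matches the calculus with Cut. What remains is cut elimination: an
outer induction on the size of the cut formula (`cutAdmissible`), an inner one on the left
derivation (`SC.cut_of_smaller`), and, once that ends in a rule introducing the cut formula, one on
the right derivation (`Reducible.cut`). The delicate rules are Fix and PrePost, whose first premise
assumes the conclusion or its precondition. -/

theorem ND.weaken {Γ : Set (Formula Atom)} {r : Formula Atom} (h : ND Γ r) :
    ∀ {Δ : Set (Formula Atom)}, Γ ⊆ Δ → ND Δ r := by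
  have ins {Γ Δ : Set (Formula Atom)} {p : Formula Atom} (h : Γ ⊆ Δ) : insert p Γ ⊆ insert p Δ :=
    Set.insert_subset_insert h
  induction h with
  | id hp => exact fun s => .id (s hp)
  | topI => exact fun _ => .topI
  | botE _ ih => exact fun s => .botE (ih s)
  | negI _ ih => exact fun s => .negI (ih (ins s))
  | negE _ _ ih₁ ih₂ => exact fun s => .negE (ih₁ s) (ih₂ s)
  | andI _ _ ih₁ ih₂ => exact fun s => .andI (ih₁ s) (ih₂ s)
  | andE1 _ ih => exact fun s => .andE1 (ih s)
  | andE2 _ ih => exact fun s => .andE2 (ih s)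
  | orI1 _ ih => exact fun s => .orI1 (ih s)
  | orI2 _ ih => exact fun s => .orI2 (ih s)
  | orE _ _ _ ih₁ ih₂ ih₃ => exact fun s => .orE (ih₁ s) (ih₂ (ins s)) (ih₃ (ins s))
  | impI _ ih => exact fun s => .impI (ih (ins s))
  | impE _ _ ih₁ ih₂ => exact fun s => .impE (ih₁ s) (ih₂ s)
  | coimpI1 _ ih => exact fun s => .coimpI1 (ih s)
  | coimpI2 _ _ _ ih₁ ih₂ ih₃ => exact fun s => .coimpI2 (ih₁ s) (ih₂ (ins s)) (ih₃ (ins s))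
  | coimpE _ _ ih₁ ih₂ => exact fun s => .coimpE (ih₁ s) (ih₂ (ins s))

theorem ND.cut {Γ : Set (Formula Atom)} {p r : Formula Atom} (h₁ : ND Γ p)
    (h₂ : ND (insert p Γ) r) : ND Γ r :=
  .impE (.impI h₂) h₁

theorem SC.weaken {c : Bool} {Γ : Set (Formula Atom)} {r : Formula Atom} (h : SC c Γ r) :
    ∀ {Δ : Set (Formula Atom)}, Γ ⊆ Δ → SC c Δ r := by
  have ins {Γ Δ : Set (Formula Atom)} {p : Formula Atom} (h : Γ ⊆ Δ) : insert p Γ ⊆ insert p Δ :=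
    Set.insert_subset_insert h
  induction h with
  | id hp => exact fun s => .id (s hp)
  | cut hc _ _ ih₁ ih₂ => exact fun s => .cut hc (ih₁ s) (ih₂ (ins s))
  | topR => exact fun _ => .topR
  | botL hp => exact fun s => .botL (s hp)
  | negR _ ih => exact fun s => .negR (ih (ins s))
  | negL hp _ ih => exact fun s => .negL (s hp) (ih s)
  | andR _ _ ih₁ ih₂ => exact fun s => .andR (ih₁ s) (ih₂ s)
  | andL1 hp _ ih => exact fun s => .andL1 (s hp) (ih (ins s))
  | andL2 hp _ ih => exact fun s => .andL2 (s hp) (ih (ins s))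
  | orR1 _ ih => exact fun s => .orR1 (ih s)
  | orR2 _ ih => exact fun s => .orR2 (ih s)
  | orL hp _ _ ih₁ ih₂ => exact fun s => .orL (s hp) (ih₁ (ins s)) (ih₂ (ins s))
  | impR _ ih => exact fun s => .impR (ih (ins s))
  | impL hp _ _ ih₁ ih₂ => exact fun s => .impL (s hp) (ih₁ s) (ih₂ (ins s))
  | zero _ ih => exact fun s => .zero (ih s)
  | fix hp _ _ ih₁ ih₂ => exact fun s => .fix (s hp) (ih₁ (ins s)) (ih₂ (ins s))
  | prePost hp _ _ ih₁ ih₂ => exact fun s => .prePost (s hp) (ih₁ (ins s)) (ih₂ (ins s))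

theorem SC.toND {c : Bool} {Γ : Set (Formula Atom)} {r : Formula Atom} (h : SC c Γ r) :
    ND Γ r := by
  induction h with
  | id hp => exact .id hp
  | cut _ _ _ ih₁ ih₂ => exact ih₁.cut ih₂
  | topR => exact .topI
  | botL hp => exact .botE (.id hp)
  | negR _ ih => exact .negI ih
  | negL hp _ ih => exact .botE (.negE (.id hp) ih)
  | andR _ _ ih₁ ih₂ => exact .andI ih₁ ih₂
  | andL1 hp _ ih => exact (ND.andE1 (.id hp)).cut ih
  | andL2 hp _ ih => exact (ND.andE2 (.id hp)).cut ih
  | orR1 _ ih => exact .orI1 ih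
  | orR2 _ ih => exact .orI2 ih
  | orL hp _ _ ih₁ ih₂ => exact .orE (.id hp) ih₁ ih₂
  | impR _ ih => exact .impI ih
  | impL hp _ _ ih₁ ih₂ => exact (ND.impE (.id hp) ih₁).cut ih₂
  | zero _ ih => exact .coimpI1 ih
  -- Fix is `coimpE` applied to `r ↠ r`, which `coimpI2` derives from `p ↠ q`.
  | @fix Γ p q r hp _ _ ih₁ ih₂ =>
    have h : ND Γ (coimp r r) := .coimpI2 (.id hp) ih₁ (.coimpI1 ih₂)
    exact .coimpE h (.id (Set.mem_insert _ _))
  | prePost hp _ _ ih₁ ih₂ => exact .coimpI2 (.id hp) ih₁ ih₂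

/-! ### Cut elimination -/

/-- A variant of the rule (Fix) in which the conclusion is not assumed in the first premise. -/
theorem SC.fix_of_post {c : Bool} {Γ : Set (Formula Atom)} {p q r : Formula Atom}
    (hp : coimp p q ∈ Γ) (h₁ : SC c (insert q Γ) p) (h₂ : SC c (insert q Γ) r) : SC c Γ r :=
  .fix hp
    -- The inner Fix concludes `p` itself, so its first premise is an identity.
    (.fix (Set.mem_insert_of_mem _ hp) (.id (Set.mem_insert _ _))
      (h₁.weaken (Set.insert_subset_insert (Set.subset_insert _ _))))
    h₂

/-- Cut on the formula `A` is admissible in the calculus without (Cut). -/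
def CutAdmissible (A : Formula Atom) : Prop :=
  ∀ ⦃Γ : Set (Formula Atom)⦄ ⦃r : Formula Atom⦄,
    SC false Γ A → SC false (insert A Γ) r → SC false Γ r

/-- In every extension of `Γ`, the assumption `A` can be removed from a cut-free proof ending with
a left rule whose principal formula is `A`, once it has been removed from the premises. -/
structure Reducible (Γ : Set (Formula Atom)) (A : Formula Atom) : Prop where
  proof : SC false Γ A
  bot : A ≠ bot
  neg : ∀ p, A = neg p → ∀ Δ, Γ ⊆ Δ → ∀ r, SC false Δ p → SC false Δ r
  and1 : ∀ p q, A = conj p q → ∀ Δ, Γ ⊆ Δ → ∀ r, SC false (insert p Δ) r → SC false Δ r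
  and2 : ∀ p q, A = conj p q → ∀ Δ, Γ ⊆ Δ → ∀ r, SC false (insert q Δ) r → SC false Δ r
  or : ∀ p q, A = disj p q → ∀ Δ, Γ ⊆ Δ → ∀ r,
    SC false (insert p Δ) r → SC false (insert q Δ) r → SC false Δ r
  imp : ∀ p q, A = imp p q → ∀ Δ, Γ ⊆ Δ → ∀ r,
    SC false Δ p → SC false (insert q Δ) r → SC false Δ r
  fix : ∀ p q, A = coimp p q → ∀ Δ, Γ ⊆ Δ → ∀ r,
    SC false (insert r Δ) p → SC false (insert q Δ) r → SC false Δ r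
  prePost : ∀ p q, A = coimp p q → ∀ Δ, Γ ⊆ Δ → ∀ a b,
    SC false (insert a Δ) p → SC false (insert q Δ) (coimp a b) → SC false Δ (coimp a b)

/-- Every rule not acting on `A` is simply reapplied; where `A` is principal, the matching field of
`Reducible` replaces the rule. Letting `Δ` grow accommodates the formulae added in premises. -/
theorem Reducible.cut {Γ Γ' : Set (Formula Atom)} {A r : Formula Atom} (hA : Reducible Γ A)
    (h : SC false Γ' r) : ∀ {Δ : Set (Formula Atom)}, Γ ⊆ Δ → Γ' ⊆ insert A Δ → SC false Δ r := by
  have up {Δ : Set (Formula Atom)} {p : Formula Atom} (s : Γ ⊆ Δ) : Γ ⊆ insert p Δ :=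
    s.trans (Set.subset_insert _ _)
  have ins {Γ Δ : Set (Formula Atom)} {p : Formula Atom} (t : Γ ⊆ insert A Δ) :
      insert p Γ ⊆ insert A (insert p Δ) := by
    rw [Set.insert_comm]
    exact Set.insert_subset_insert t
  induction h with
  | id hp =>
    intro Δ s t
    rcases t hp with rfl | hp
    · exact hA.proof.weaken s
    · exact .id hp
  | cut hc => exact absurd hc (by simp)
  | topR => exact fun _ _ => .topR
  | botL hp =>
    intro Δ s t
    rcases t hp with e | hp
    · exact absurd e.symm hA.bot
    · exact .botL hp
  | negR _ ih => exact fun s t => .negR (ih (up s) (ins t))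
  | negL hp _ ih =>
    intro Δ s t
    rcases t hp with e | hp
    · exact hA.neg _ e.symm Δ s _ (ih s t)
    · exact .negL hp (ih s t)
  | andR _ _ ih₁ ih₂ => exact fun s t => .andR (ih₁ s t) (ih₂ s t)
  | andL1 hp _ ih =>
    intro Δ s t
    rcases t hp with e | hp
    · exact hA.and1 _ _ e.symm Δ s _ (ih (up s) (ins t))
    · exact .andL1 hp (ih (up s) (ins t))
  | andL2 hp _ ih =>
    intro Δ s t
    rcases t hp with e | hp
    · exact hA.and2 _ _ e.symm Δ s _ (ih (up s) (ins t))
    · exact .andL2 hp (ih (up s) (ins t))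
  | orR1 _ ih => exact fun s t => .orR1 (ih s t)
  | orR2 _ ih => exact fun s t => .orR2 (ih s t)
  | orL hp _ _ ih₁ ih₂ =>
    intro Δ s t
    rcases t hp with e | hp
    · exact hA.or _ _ e.symm Δ s _ (ih₁ (up s) (ins t)) (ih₂ (up s) (ins t))
    · exact .orL hp (ih₁ (up s) (ins t)) (ih₂ (up s) (ins t))
  | impR _ ih => exact fun s t => .impR (ih (up s) (ins t))
  | impL hp _ _ ih₁ ih₂ =>
    intro Δ s t
    rcases t hp with e | hp
    · exact hA.imp _ _ e.symm Δ s _ (ih₁ s t) (ih₂ (up s) (ins t))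
    · exact .impL hp (ih₁ s t) (ih₂ (up s) (ins t))
  | zero _ ih => exact fun s t => .zero (ih s t)
  | fix hp _ _ ih₁ ih₂ =>
    intro Δ s t
    rcases t hp with e | hp
    · exact hA.fix _ _ e.symm Δ s _ (ih₁ (up s) (ins t)) (ih₂ (up s) (ins t))
    · exact .fix hp (ih₁ (up s) (ins t)) (ih₂ (up s) (ins t))
  | prePost hp _ _ ih₁ ih₂ =>
    intro Δ s t
    rcases t hp with e | hp
    · exact hA.prePost _ _ e.symm Δ s _ _ (ih₁ (up s) (ins t)) (ih₂ (up s) (ins t))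
    · exact .prePost hp (ih₁ (up s) (ins t)) (ih₂ (up s) (ins t))

/-- A final left rule lets the cut move up into the premises proving `A`. A final right rule makes
`A` reducible by cuts on its immediate subformulae. PrePost is handled as a right rule, yet also
needs the inner induction hypothesis. -/
theorem SC.cut_of_smaller {Γ : Set (Formula Atom)} {A : Formula Atom} (h : SC false Γ A) :
    (∀ B : Formula Atom, sizeOf B < sizeOf A → CutAdmissible B) →
    ∀ {Δ : Set (Formula Atom)} {r : Formula Atom}, Γ ⊆ Δ → SC false (insert A Δ) r →
      SC false Δ r := by
  have ins {Γ Δ : Set (Formula Atom)} {p : Formula Atom} (h : Γ ⊆ Δ) : insert p Γ ⊆ insert p Δ :=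
    Set.insert_subset_insert h
  have wk {Δ : Set (Formula Atom)} {p q r : Formula Atom} (h : SC false (insert p Δ) r) :
      SC false (insert p (insert q Δ)) r := h.weaken (ins (Set.subset_insert _ _))
  induction h with
  | id hp =>
    intro _ Δ r s h
    rwa [Set.insert_eq_of_mem (s hp)] at h
  | cut hc => exact absurd hc (by simp)
  | topR =>
    intro _ Δ r s h
    refine Reducible.cut (Γ := Δ) ⟨.topR, ?_, ?_, ?_, ?_, ?_, ?_, ?_, ?_⟩ h subset_rfl subset_rfl
      <;> simp
  | botL hp => exact fun _ _ _ s _ => .botL (s hp)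
  | @negR Γ p h₁ =>
    intro sm Δ r s h
    refine Reducible.cut (Γ := Γ) ⟨.negR h₁, ?_, ?_, ?_, ?_, ?_, ?_, ?_, ?_⟩ h s subset_rfl <;>
      try (simp; done)
    rintro _ ⟨⟩ Δ s r h
    -- `bot` is smaller than any negation, so a cut on it is allowed.
    exact sm bot (by cases p <;> simp) (sm p (by simp) h (h₁.weaken (ins s)))
      (.botL (Set.mem_insert _ _))
  | negL hp h₁ => exact fun _ _ _ s _ => .negL (s hp) (h₁.weaken s)
  | @andR Γ p q h₁ h₂ =>
    intro sm Δ r s h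
    refine Reducible.cut (Γ := Γ) ⟨.andR h₁ h₂, ?_, ?_, ?_, ?_, ?_, ?_, ?_, ?_⟩ h s subset_rfl <;>
      try (simp; done)
    · rintro _ _ ⟨⟩ Δ s r h
      exact sm p (by simp; omega) (h₁.weaken s) h
    · rintro _ _ ⟨⟩ Δ s r h
      exact sm q (by simp) (h₂.weaken s) h
  | andL1 hp _ ih => exact fun sm _ _ s h => .andL1 (s hp) (ih sm (ins s) (wk h))
  | andL2 hp _ ih => exact fun sm _ _ s h => .andL2 (s hp) (ih sm (ins s) (wk h))
  | @orR1 Γ p q h₁ =>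
    intro sm Δ r s h
    refine Reducible.cut (Γ := Γ) ⟨.orR1 h₁, ?_, ?_, ?_, ?_, ?_, ?_, ?_, ?_⟩ h s subset_rfl <;>
      try (simp; done)
    rintro _ _ ⟨⟩ Δ s r h _
    exact sm p (by simp; omega) (h₁.weaken s) h
  | @orR2 Γ p q h₁ =>
    intro sm Δ r s h
    refine Reducible.cut (Γ := Γ) ⟨.orR2 h₁, ?_, ?_, ?_, ?_, ?_, ?_, ?_, ?_⟩ h s subset_rfl <;>
      try (simp; done)
    rintro _ _ ⟨⟩ Δ s r _ h
    exact sm q (by simp) (h₁.weaken s) h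
  | orL hp _ _ ih₁ ih₂ =>
    exact fun sm _ _ s h => .orL (s hp) (ih₁ sm (ins s) (wk h)) (ih₂ sm (ins s) (wk h))
  | @impR Γ p q h₁ =>
    intro sm Δ r s h
    refine Reducible.cut (Γ := Γ) ⟨.impR h₁, ?_, ?_, ?_, ?_, ?_, ?_, ?_, ?_⟩ h s subset_rfl <;>
      try (simp; done)
    rintro _ _ ⟨⟩ Δ s r hp hq
    exact sm q (by simp) (sm p (by simp; omega) hp (h₁.weaken (ins s))) hq
  | impL hp h₁ _ _ ih => exact fun sm _ _ s h => .impL (s hp) (h₁.weaken s) (ih sm (ins s) (wk h))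
  | @zero Γ p q h₁ =>
    intro sm Δ r s h
    refine Reducible.cut (Γ := Γ) ⟨.zero h₁, ?_, ?_, ?_, ?_, ?_, ?_, ?_, ?_⟩ h s subset_rfl <;>
      try (simp; done)
    · rintro _ _ ⟨⟩ Δ s r _ h
      exact sm q (by simp) (h₁.weaken s) h
    · rintro _ _ ⟨⟩ Δ s a b _ h
      exact sm q (by simp) (h₁.weaken s) h
  -- The first premise assumes `A`, which the new conclusion need not yield. Cutting it against the
  -- second premise gives `p` from `q` instead.
  | fix hp h₁ _ _ ih =>
    exact fun sm _ _ s h =>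
      .fix_of_post (s hp) (ih sm (ins s) (wk (h₁.weaken (ins s)))) (ih sm (ins s) (wk h))
  | @prePost Γ p q a b hp h₁ h₂ _ ih =>
    intro sm Δ r s h
    have sa : CutAdmissible a := sm a (by simp; omega)
    refine Reducible.cut (Γ := Γ) ⟨.prePost hp h₁ h₂, ?_, ?_, ?_, ?_, ?_, ?_, ?_, ?_⟩ h s subset_rfl
      <;> try (simp; done)
    · rintro _ _ ⟨⟩ Δ s r hr hb
      -- The use of `a ↠ b` is restored so that it can be cut against the second premise of PrePost;
      -- a cut on the smaller `a` supplies `p`.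
      have h : SC false (insert (coimp a b) Δ) r := .fix (Set.mem_insert _ _)
        (hr.weaken (ins (Set.subset_insert _ _))) (wk hb)
      exact .fix (s hp) (sa hr (wk (h₁.weaken (ins s)))) (ih sm (ins s) (wk h))
    · rintro _ _ ⟨⟩ Δ s c d hc hb
      have h : SC false (insert (coimp a b) Δ) (coimp c d) := .prePost (Set.mem_insert _ _)
        (wk hc) (wk hb)
      exact .prePost (s hp) (sa hc (wk (h₁.weaken (ins s)))) (ih sm (ins s) (wk h))

theorem cutAdmissible (A : Formula Atom) : CutAdmissible A :=
  fun _ _ h₁ h₂ => h₁.cut_of_smaller (fun B _ => cutAdmissible B) subset_rfl h₂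
termination_by sizeOf A

theorem SC.eliminate_cut {c : Bool} {Γ : Set (Formula Atom)} {r : Formula Atom} (h : SC c Γ r) :
    SC false Γ r := by
  induction h with
  | id hp => exact .id hp
  | cut _ _ _ ih₁ ih₂ => exact cutAdmissible _ ih₁ ih₂
  | topR => exact .topR
  | botL hp => exact .botL hp
  | negR _ ih => exact .negR ih
  | negL hp _ ih => exact .negL hp ih
  | andR _ _ ih₁ ih₂ => exact .andR ih₁ ih₂
  | andL1 hp _ ih => exact .andL1 hp ih
  | andL2 hp _ ih => exact .andL2 hp ih
  | orR1 _ ih => exact .orR1 ih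
  | orR2 _ ih => exact .orR2 ih
  | orL hp _ _ ih₁ ih₂ => exact .orL hp ih₁ ih₂
  | impR _ ih => exact .impR ih
  | impL hp _ _ ih₁ ih₂ => exact .impL hp ih₁ ih₂
  | zero _ ih => exact .zero ih
  | fix hp _ _ ih₁ ih₂ => exact .fix hp ih₁ ih₂
  | prePost hp _ _ ih₁ ih₂ => exact .prePost hp ih₁ ih₂

theorem ND.toSC {Γ : Set (Formula Atom)} {r : Formula Atom} (h : ND Γ r) : SC true Γ r := by
  have hd {Γ : Set (Formula Atom)} {p : Formula Atom} : p ∈ insert p Γ := Set.mem_insert _ _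
  have wk {Γ : Set (Formula Atom)} {p r : Formula Atom} (h : SC true Γ r) :
      SC true (insert p Γ) r := h.weaken (Set.subset_insert _ _)
  have wk₂ {Γ : Set (Formula Atom)} {p q r : Formula Atom} (h : SC true (insert p Γ) r) :
      SC true (insert p (insert q Γ)) r :=
    h.weaken (Set.insert_subset_insert (Set.subset_insert _ _))
  induction h with
  | id hp => exact .id hp
  | topI => exact .topR
  | botE _ ih => exact .cut rfl ih (.botL hd)
  | negI _ ih => exact .negR ih
  | negE _ _ ih₁ ih₂ => exact .cut rfl ih₁ (.negL hd (wk ih₂))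
  | andI _ _ ih₁ ih₂ => exact .andR ih₁ ih₂
  | andE1 _ ih => exact .cut rfl ih (.andL1 hd (.id hd))
  | andE2 _ ih => exact .cut rfl ih (.andL2 hd (.id hd))
  | orI1 _ ih => exact .orR1 ih
  | orI2 _ ih => exact .orR2 ih
  | orE _ _ _ ih₁ ih₂ ih₃ => exact .cut rfl ih₁ (.orL hd (wk₂ ih₂) (wk₂ ih₃))
  | impI _ ih => exact .impR ih
  | impE _ _ ih₁ ih₂ => exact .cut rfl ih₁ (.impL hd (wk ih₂) (.id hd))
  | coimpI1 _ ih => exact .zero ih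
  | coimpI2 _ _ _ ih₁ ih₂ ih₃ => exact .cut rfl ih₁ (.prePost hd (wk₂ ih₂) (wk₂ ih₃))
  | coimpE _ _ ih₁ ih₂ => exact .cut rfl ih₁ (.fix hd (wk₂ ih₂) (.id hd))

end PCL

theorem mainTheorem5 {Atom : Type*} (Δ : Set (PCL.Formula Atom)) (p : PCL.Formula Atom) :
    (PCL.ND Δ p ↔ PCL.SC true Δ p) ∧ (PCL.ND Δ p ↔ PCL.SC false Δ p) :=
  ⟨⟨PCL.ND.toSC, PCL.SC.toND⟩, ⟨fun h => h.toSC.eliminate_cut, PCL.SC.toND⟩⟩
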